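/- Let $T$ be the infinite rooted tree in which every vertex has four children, numbered $\alpha=0,1,2,3$; the root has depth $1$, so there are $4^{k-1}$ vertices of depth $k$. Give each vertex $v$ an angle $\omega_v\in[0,\frac{\pi}{2}]$. Starting from the closed unit disk $\mathcal D_0\subset\mathbb C$, which is attached to the root, construct closed disks inductively. A disk with centre $z$ and radius $r=4^{-(k-1)}$ attached to a vertex $v$ of depth $k$ is replaced by the four closed disks of radius $r/4$ with centres $$z+\tfrac34\,r\,e^{i(\alpha\frac{\pi}{2}-\omega_v)},\qquad \alpha=0,1,2,3,$$ the $\alpha$-th of which is attached to the $\alpha$-th child of $v$. Let $\mathcal D_n$ be the union of the $4^n$ disks of radius $4^{-n}$ obtained after $n$ steps; it depends only on the angles at the vertices of depth $1,\dots,n$. For $E\subset\mathbb C$ and $\theta\in\mathbb R$ let $|\mathrm{proj}_\theta E|$ be the one-dimensional Lebesgue measure of the orthogonal projection of $E$ onto the line through the origin with direction $e^{i\theta}$, and let $\mathrm{Fav}(E)=\frac1\pi\int_0^\pi|\mathrm{proj}_\theta E|\,d\theta$. There is an absolute constant $c>0$ with the following properties. 1. For every integer $n\ge1$, if the angles $\omega_v$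 at the vertices of depth $1,\dots,n$ are independent random variables, each uniformly distributed on $[0,\frac{\pi}{2}]$, then $$\mathbb E\,|\mathrm{proj}_\theta\mathcal D_n|\le\frac cn\quad\text{for every }\theta\in\mathbb R,\qquad\text{and}\qquad \mathbb E[\mathrm{Fav}(\mathcal D_n)]\le\frac cn .$$ 2. If the angles at all vertices of $T$ are independent and uniformly distributed on $[0,\frac{\pi}{2}]$, then almost surely $$\liminf_{n\to\infty} n\,\mathrm{Fav}(\mathcal D_n)<\infty .$$ -/

import Mathlib

open MeasureTheory ProbabilityTheory Filter
open scoped ENNReal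

namespace DiskCantor

/-- A node of the infinite rooted tree with four branches at each vertex. A node is the word of the
branches `0, 1, 2, 3` (East, North, West, South) taken to reach it, the most recent one first:
`[]` is the root, and `α :: w` is the child number `α` of `w`. The `4 ^ (k - 1)` words of length
`k - 1` are the nodes at depth `k`. -/
abbrev Node : Type := List (Fin 4)

/-- The nodes of the tree of height `n`, that is, those at depths `1, …, n`. -/
def nodesOfHeight (n : ℕ) : Set Node := {w | w.length < n}

/-- The centre of the disk labelled by a word, for a tree of angles `ω`. The four disks that replace
the disk labelled `w`, of radius `4 ^ (-|w|)`, have their centres at distance `3/4 * 4 ^ (-|w|)`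
from its centre, in the four compass directions rotated clockwise by the angle `ω w`. -/
noncomputable def center (ω : Node → ℝ) : Node → ℂ
  | [] => 0
  | α :: w => center ω w +
      (1 / 4 : ℂ) ^ w.length *
        ((3 / 4 : ℂ) * Complex.exp (((((α : ℕ) : ℝ) * (Real.pi / 2) - ω w : ℝ) : ℂ) * Complex.I))

/-- The `n`-th generation: the union of the `4 ^ n` closed disks of radius `4 ^ (-n)`. It depends
only on the angles at the nodes of the tree of height `n`. -/
noncomputable def generation (n : ℕ) (ω : Node → ℝ) : Set ℂ :=
  ⋃ w ∈ {w : Node | w.length = n}, Metric.closedBall (center ω w) ((1 / 4 : ℝ) ^ n)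

/-- The length of the orthogonal projection of `E` onto the line through the origin with direction
`exp (i θ)`; the point of that line closest to `z` is `t * exp (i θ)`, `t = Re (z * exp (-i θ))`. -/
noncomputable def projLength (θ : ℝ) (E : Set ℂ) : ℝ≥0∞ :=
  volume ((fun z : ℂ => (z * Complex.exp (-(θ : ℂ) * Complex.I)).re) '' E)

/-- The Favard length `(1 / π) ∫_0^π |proj_θ E| dθ`. -/
noncomputable def favardLength (E : Set ℂ) : ℝ≥0∞ :=
  ENNReal.ofReal (1 / Real.pi) * ∫⁻ θ in Set.Icc (0 : ℝ) Real.pi, projLength θ E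

/-- The angles at the nodes in `S` are independent random variables, each of them uniformly
distributed on `[0, π / 2]`. -/
structure IsUniformTree {Ω : Type*} [MeasurableSpace Ω] (P : Measure Ω) (S : Set Node)
    (ω : Node → Ω → ℝ) : Prop where
  measurable : ∀ w ∈ S, Measurable (ω w)
  uniform : ∀ w ∈ S, pdf.IsUniform (ω w) (Set.Icc 0 (Real.pi / 2)) P volume
  indep : iIndepFun (fun w : S => ω w) P

end DiskCantor

/-!
Fix a direction `θ` and let `q n` (`meanLength`) be the expected length of the projection of the
`n`-th generation. The theorem follows from the recursive inequality
`q (n + 1) + q n ^ 2 / 80 ≤ q n` (`meanLength_succ_add_le`), which gives `n * q n ≤ 80`.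

The random set is self-similar from the root: its projection of generation `n + 1` is the union of
four copies of that of generation `n`, scaled by `1 / 4` and translated to the projected centres of
the children, and given the angle at the root the four copies are independent. So the probability
`f n s` (`hitProb`) that the projection contains `s` satisfies an explicit recursion
(`measure_mem_shadow`), and `q n` is the integral of `f n`. The lengths of the four copies have
expected sum `q n`, and the length of their union falls short of this sum at least by the overlaps
of the two pairs of opposite children (`one_sub_prod_add_le`). The expected overlap of a pair whose
projected centres lie at distance `t / 4` is a quarter of `∫ f n y * f n (y + t) dy` (`overlap`), a
function of `t` that is even, vanishes for `2 < |t|`, and has integral `q n ^ 2`. For the two pairs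
`t` is `6 * cos ψ` and `6 * sin ψ`, where `ψ` is uniform on an interval of length `π / 2`. The sum
of the two overlaps has period `π / 2` in `ψ`, so that the direction `θ` plays no role, and the
distribution of `6 * sin ψ` has a density bounded below on `(0, 6)`; hence the expected overlap is at
least `q n ^ 2 / 80` (`meanLength_sq_le`).

Averaging over `θ` gives the bound on the expected Favard length, and Fatou's lemma the almost sure
statement.
-/

namespace DiskCantor

/-! ### The projection of a generation -/

/-- The signed distance from the centre of the unit disk to that of its child number `α`, after
projection to the direction `θ`, when the angle at the root is `φ`. -/
noncomputable def offset (θ φ : ℝ) (α : Fin 4) : ℝ :=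
  3 / 4 * Real.cos (((α : ℕ) : ℝ) * (Real.pi / 2) - φ - θ)

/-- The tree of angles below child number `α` of the root. Since words list the most recent branch
first, the branch taken at the root is the last letter. -/
def subtree {X : Type*} (α : Fin 4) (ω : Node → X) : Node → X := fun w => ω (w ++ [α])

/-- The projection of the `n`-th generation to the direction `θ`, as a set of coordinates,
described by self-similarity from the root. -/
def shadow (θ : ℝ) : ℕ → (Node → ℝ) → Set ℝ
  | 0, _ => Set.Icc (-1) 1
  | n + 1, ω => {s | ∃ α, 4 * (s - offset θ (ω []) α) ∈ shadow θ n (subtree α ω)}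

theorem mem_shadow_succ {θ : ℝ} {n : ℕ} {ω : Node → ℝ} {s : ℝ} :
    s ∈ shadow θ (n + 1) ω ↔ ∃ α, 4 * (s - offset θ (ω []) α) ∈ shadow θ n (subtree α ω) :=
  Iff.rfl

theorem center_append_singleton (ω : Node → ℝ) (α : Fin 4) (w : Node) :
    center ω (w ++ [α]) =
      (3 / 4 : ℂ) * Complex.exp (((((α : ℕ) : ℝ) * (Real.pi / 2) - ω [] : ℝ) : ℂ) * Complex.I) +
        (1 / 4 : ℂ) * center (subtree α ω) w := by
  induction w with
  | nil => simp [center]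
  | cons β w ih =>
    simp only [List.cons_append, center, ih, subtree, List.length_append, List.length_singleton]
    ring

theorem mem_shadow_of_mem_generation (θ : ℝ) (n : ℕ) :
    ∀ (ω : Node → ℝ) (z : ℂ), z ∈ generation n ω →
      (z * Complex.exp (-(θ : ℂ) * Complex.I)).re ∈ shadow θ n ω := by
  have hexp : ‖Complex.exp (-(θ : ℂ) * Complex.I)‖ = 1 := by
    rw [← Complex.ofReal_neg, Complex.norm_exp_ofReal_mul_I]
  induction n with
  | zero =>
    intro ω z hz
    simp only [generation, Set.mem_ofPred_eq, List.length_eq_zero_iff, Set.iUnion_iUnion_eq_left,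
      center, pow_zero, Metric.mem_closedBall, dist_zero_right] at hz
    rw [shadow, Set.mem_Icc, ← abs_le]
    refine (Complex.abs_re_le_norm _).trans ?_
    rwa [norm_mul, hexp, mul_one]
  | succ n ih =>
    intro ω z hz
    simp only [generation, Set.mem_iUnion, Set.mem_ofPred_eq, exists_prop] at hz
    obtain ⟨w, hw, hz⟩ := hz
    obtain ⟨v, α, rfl⟩ : ∃ (v : Node) (α : Fin 4), w = v ++ [α] :=
      ⟨w.dropLast, w.getLast (by rintro rfl; simp at hw), (List.dropLast_append_getLast _).symm⟩
    have hv : v.length = n := by simpa using hw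
    set e := Complex.exp (((((α : ℕ) : ℝ) * (Real.pi / 2) - ω [] : ℝ) : ℂ) * Complex.I) with he
    have hmem : 4 * (z - 3 / 4 * e) ∈ generation n (subtree α ω) := by
      simp only [generation, Set.mem_iUnion, Set.mem_ofPred_eq, exists_prop]
      refine ⟨v, hv, ?_⟩
      rw [Metric.mem_closedBall, dist_eq_norm] at hz ⊢
      rw [center_append_singleton, ← he] at hz
      have : 4 * (z - 3 / 4 * e) - center (subtree α ω) v
          = 4 * (z - (3 / 4 * e + 1 / 4 * center (subtree α ω) v)) := by ring
      rw [this, norm_mul]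
      rw [pow_succ] at hz
      norm_num at hz ⊢
      linarith
    refine ⟨α, ?_⟩
    have hre : (4 * (z - 3 / 4 * e) * Complex.exp (-(θ : ℂ) * Complex.I)).re
        = 4 * ((z * Complex.exp (-(θ : ℂ) * Complex.I)).re - offset θ (ω []) α) := by
      have h1 : e * Complex.exp (-(θ : ℂ) * Complex.I)
          = Complex.exp (((((α : ℕ) : ℝ) * (Real.pi / 2) - ω [] - θ : ℝ) : ℂ) * Complex.I) := by
        rw [he, ← Complex.exp_add]
        congr 1
        push_cast
        ring
      have h2 : 4 * (z - 3 / 4 * e) * Complex.exp (-(θ : ℂ) * Complex.I)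
          = ((4 : ℝ) : ℂ) * (z * Complex.exp (-(θ : ℂ) * Complex.I)
            - ((3 / 4 : ℝ) : ℂ) * (e * Complex.exp (-(θ : ℂ) * Complex.I))) := by
        push_cast
        ring
      rw [h2, h1, Complex.re_ofReal_mul, Complex.sub_re, Complex.re_ofReal_mul,
        Complex.exp_ofReal_mul_I_re, offset]
    rw [← hre]
    exact ih _ _ hmem

theorem projLength_generation_le (θ : ℝ) (n : ℕ) (ω : Node → ℝ) :
    projLength θ (generation n ω) ≤ volume (shadow θ n ω) := by
  refine measure_mono ?_
  rintro _ ⟨z, hz, rfl⟩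
  exact mem_shadow_of_mem_generation θ n ω z hz

/-- The shadow of generation `n` depends only on the angles in the tree of height `n`. -/
theorem shadow_congr (θ : ℝ) (n : ℕ) :
    ∀ {ω ω' : Node → ℝ}, (∀ w ∈ nodesOfHeight n, ω w = ω' w) → shadow θ n ω = shadow θ n ω' := by
  induction n with
  | zero => intro ω ω' _; rfl
  | succ n ih =>
    intro ω ω' h
    have h0 : ω [] = ω' [] := h [] (by simp [nodesOfHeight])
    have hs (α : Fin 4) : shadow θ n (subtree α ω) = shadow θ n (subtree α ω') := by
      refine ih fun w hw => h _ ?_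
      simp only [nodesOfHeight, Set.mem_ofPred_eq, List.length_append, List.length_singleton] at hw ⊢
      omega
    simp only [shadow, h0, hs]

theorem measurable_offset {X : Type*} [MeasurableSpace X] {θ φ : X → ℝ} (hθ : Measurable θ)
    (hφ : Measurable φ) (α : Fin 4) : Measurable fun x => offset (θ x) (φ x) α := by
  unfold offset
  fun_prop

theorem measurableSet_mem_shadow {X : Type*} [MeasurableSpace X] {θ : X → ℝ} (hθ : Measurable θ)
    (n : ℕ) :
    ∀ {s : X → ℝ} {ω : X → Node → ℝ}, Measurable s →
      (∀ w ∈ nodesOfHeight n, Measurable fun x => ω x w) →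
      MeasurableSet {x | s x ∈ shadow (θ x) n (ω x)} := by
  induction n with
  | zero => intro s ω hs _; exact hs measurableSet_Icc
  | succ n ih =>
    intro s ω hs hω
    simp only [mem_shadow_succ, Set.ofPred_exists]
    refine MeasurableSet.iUnion fun α => ih (s := fun x => 4 * (s x - offset (θ x) (ω x []) α))
      (ω := fun x => subtree α (ω x)) ?_ fun w hw => hω _ ?_
    · exact (hs.sub (measurable_offset hθ (hω [] (by simp [nodesOfHeight])) α)).const_mul 4
    · simp only [nodesOfHeight, Set.mem_ofPred_eq, List.length_append, List.length_singleton] at hw ⊢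
      omega

/-! ### The probability of hitting a point -/

/-- The uniform distribution of an angle on `[0, π / 2]`. -/
noncomputable def angleLaw : Measure ℝ := ProbabilityTheory.cond volume (Set.Icc 0 (Real.pi / 2))

instance : IsProbabilityMeasure angleLaw := by
  refine cond_isProbabilityMeasure_of_finite ?_ ?_
  · simp [Real.pi_pos]
  · simp

theorem lintegral_angleLaw (f : ℝ → ℝ≥0∞) :
    ∫⁻ u, f u ∂angleLaw = ENNReal.ofReal (2 / Real.pi) * ∫⁻ u in Set.Icc 0 (Real.pi / 2), f u := by
  rw [angleLaw, ProbabilityTheory.cond, lintegral_smul_measure, Real.volume_Icc, sub_zero,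
    ← ENNReal.ofReal_inv_of_pos (by positivity), inv_div, smul_eq_mul]

/-- The probability that the shadow of generation `n` of the random tree contains `s`: the four
children of the root miss `s` independently of each other, given the angle at the root. -/
noncomputable def hitProb (θ : ℝ) : ℕ → ℝ → ℝ≥0∞
  | 0, s => (Set.Icc (-1) 1).indicator 1 s
  | n + 1, s => ∫⁻ u, (1 - ∏ α, (1 - hitProb θ n (4 * (s - offset θ u α)))) ∂angleLaw

theorem measurable_hitProb (θ : ℝ) (n : ℕ) : Measurable (hitProb θ n) := by
  induction n with
  | zero => exact measurable_one.indicator measurableSet_Icc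
  | succ n ih =>
    refine Measurable.lintegral_prod_right' (f := fun p : ℝ × ℝ =>
      1 - ∏ α, (1 - hitProb θ n (4 * (p.1 - offset θ p.2 α)))) ?_
    refine measurable_const.sub (Finset.measurable_prod _ fun α _ => measurable_const.sub
      (ih.comp ((measurable_fst.sub (measurable_offset measurable_const measurable_snd α)).const_mul
        4)))

theorem hitProb_le_one (θ : ℝ) (n : ℕ) (s : ℝ) : hitProb θ n s ≤ 1 := by
  cases n with
  | zero => exact Set.indicator_le_self' (fun _ _ => zero_le) s
  | succ n =>
    calc hitProb θ (n + 1) s ≤ ∫⁻ _, 1 ∂angleLaw := lintegral_mono fun u => tsub_le_self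
      _ = 1 := by simp

theorem abs_offset_le (θ φ : ℝ) (α : Fin 4) : |offset θ φ α| ≤ 3 / 4 := by
  rw [offset, abs_mul, abs_of_pos (by norm_num : (0 : ℝ) < 3 / 4)]
  have := Real.abs_cos_le_one (((α : ℕ) : ℝ) * (Real.pi / 2) - φ - θ)
  linarith

theorem hitProb_eq_zero (θ : ℝ) (n : ℕ) : ∀ {s : ℝ}, 1 < |s| → hitProb θ n s = 0 := by
  induction n with
  | zero =>
    intro s hs
    refine Set.indicator_of_notMem ?_ _
    rw [Set.mem_Icc, ← abs_le]
    exact hs.not_ge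
  | succ n ih =>
    intro s hs
    have h (u : ℝ) (α : Fin 4) : hitProb θ n (4 * (s - offset θ u α)) = 0 := by
      refine ih ?_
      rw [abs_mul, abs_of_pos (by norm_num : (0 : ℝ) < 4)]
      have := abs_sub_abs_le_abs_sub s (offset θ u α)
      have := abs_offset_le θ u α
      linarith
    simp [hitProb, h]

/-- The expected length of the shadow of generation `n`. -/
noncomputable def meanLength (θ : ℝ) (n : ℕ) : ℝ≥0∞ := ∫⁻ s, hitProb θ n s

theorem meanLength_le_two (θ : ℝ) (n : ℕ) : meanLength θ n ≤ 2 := by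
  have h : ∀ s, hitProb θ n s ≤ (Set.Icc (-1 : ℝ) 1).indicator 1 s := by
    intro s
    by_cases hs : s ∈ Set.Icc (-1 : ℝ) 1
    · rw [Set.indicator_of_mem hs]
      exact hitProb_le_one θ n s
    · rw [hitProb_eq_zero θ n (by rwa [Set.mem_Icc, ← abs_le, not_le] at hs)]
      exact zero_le
  calc meanLength θ n ≤ ∫⁻ s, (Set.Icc (-1 : ℝ) 1).indicator 1 s := lintegral_mono h
    _ = 2 := by
      rw [lintegral_indicator_one measurableSet_Icc, Real.volume_Icc]
      norm_num

/-! ### The overlap of two opposite children -/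

theorem lintegral_comp_four_mul_sub {f : ℝ → ℝ≥0∞} (hf : Measurable f) (a : ℝ) :
    ∫⁻ s, f (4 * (s - a)) = 4⁻¹ * ∫⁻ s, f s := by
  rw [lintegral_sub_right_eq_self (fun s => f (4 * s)) a,
    ← lintegral_map hf (measurable_const_mul (4 : ℝ)),
    Real.map_volume_mul_left (by norm_num), lintegral_smul_measure, smul_eq_mul]
  congr 1
  rw [abs_of_pos (by norm_num), ENNReal.ofReal_inv_of_pos (by norm_num)]
  norm_num

/-- The autocorrelation of the hitting probability: four times the expected length of the overlap
of two independent shadows at distance `t / 4`, each scaled by `1 / 4`. -/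
noncomputable def overlap (θ : ℝ) (n : ℕ) (t : ℝ) : ℝ≥0∞ :=
  ∫⁻ y, hitProb θ n y * hitProb θ n (y + t)

theorem measurable_overlap (θ : ℝ) (n : ℕ) : Measurable (overlap θ n) := by
  have hm := measurable_hitProb θ n
  exact Measurable.lintegral_prod_right' (f := fun p : ℝ × ℝ =>
    hitProb θ n p.2 * hitProb θ n (p.2 + p.1)) (by fun_prop)

theorem overlap_neg (θ : ℝ) (n : ℕ) (t : ℝ) : overlap θ n (-t) = overlap θ n t := by
  rw [overlap, ← lintegral_add_right_eq_self _ t, overlap]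
  refine lintegral_congr fun y => ?_
  rw [add_neg_cancel_right, mul_comm]

theorem overlap_eq_zero (θ : ℝ) (n : ℕ) {t : ℝ} (ht : 2 < |t|) : overlap θ n t = 0 := by
  refine (lintegral_congr fun y => ?_).trans lintegral_zero
  by_cases hy : 1 < |y|
  · rw [hitProb_eq_zero θ n hy, zero_mul]
  · rw [hitProb_eq_zero θ n (s := y + t), mul_zero]
    have := abs_sub (y + t) y
    rw [add_sub_cancel_left] at this
    linarith

theorem lintegral_overlap (θ : ℝ) (n : ℕ) : ∫⁻ t, overlap θ n t = meanLength θ n ^ 2 := by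
  have hm := measurable_hitProb θ n
  unfold overlap
  rw [lintegral_lintegral_swap (by fun_prop)]
  have h (y : ℝ) : ∫⁻ t, hitProb θ n y * hitProb θ n (y + t) = hitProb θ n y * meanLength θ n := by
    rw [lintegral_const_mul _ (by fun_prop), lintegral_add_left_eq_self (hitProb θ n) y, meanLength]
  simp_rw [h]
  rw [lintegral_mul_const _ hm, ← meanLength, sq]

theorem lintegral_overlap_eq_two_mul (θ : ℝ) (n : ℕ) :
    ∫⁻ t, overlap θ n t = 2 * ∫⁻ t in Set.Ioo 0 6, overlap θ n t := by
  have hneg : ∫⁻ t in Set.Iio 0, overlap θ n t = ∫⁻ t in Set.Ioi 0, overlap θ n t := by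
    rw [← lintegral_indicator measurableSet_Iio, ← lintegral_indicator measurableSet_Ioi,
      ← lintegral_neg_eq_self]
    refine lintegral_congr fun t => ?_
    simp only [Set.indicator, Set.mem_Iio, Set.mem_Ioi, neg_lt_zero, overlap_neg]
  have hcut : ∫⁻ t in Set.Ioi 0, overlap θ n t = ∫⁻ t in Set.Ioo 0 6, overlap θ n t := by
    rw [← lintegral_indicator measurableSet_Ioi, ← lintegral_indicator measurableSet_Ioo]
    refine lintegral_congr fun t => ?_
    by_cases h6 : t < 6
    · simp only [Set.indicator, Set.mem_Ioi, Set.mem_Ioo, h6, and_true]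
    · have h0 : overlap θ n t = 0 := overlap_eq_zero θ n (by rw [lt_abs]; left; linarith)
      simp only [Set.indicator, h0, ite_self]
  rw [← lintegral_add_compl _ (measurableSet_Iio (a := (0 : ℝ))), Set.compl_Iio,
    setLIntegral_congr Ioi_ae_eq_Ici.symm, hneg, hcut, two_mul]

/-- The density of `6 * sin ψ`, for `ψ` uniform on a quarter turn, is bounded below on `(0, 6)`. -/
theorem lintegral_overlap_le_sin (θ : ℝ) (n : ℕ) :
    ∫⁻ t in Set.Ioo 0 6, overlap θ n t
      ≤ 6 * ∫⁻ ψ in Set.Ioo 0 (Real.pi / 2), overlap θ n (6 * Real.sin ψ) := by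
  have himg : Set.Ioo 0 6 ⊆ (fun ψ => 6 * Real.sin ψ) '' Set.Ioo 0 (Real.pi / 2) := by
    have := intermediate_value_Ioo (f := fun ψ => 6 * Real.sin ψ) (a := 0) (b := Real.pi / 2)
      (by positivity) (by fun_prop)
    simpa using this
  have hinj : Set.InjOn (fun ψ => 6 * Real.sin ψ) (Set.Ioo 0 (Real.pi / 2)) := by
    intro x hx y hy hxy
    refine Real.injOn_sin ⟨?_, hx.2.le⟩ ⟨?_, hy.2.le⟩ (mul_left_cancel₀ (by norm_num) hxy)
    · linarith [hx.1, Real.pi_pos]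
    · linarith [hy.1, Real.pi_pos]
  refine (lintegral_mono_set himg).trans ?_
  rw [lintegral_image_eq_lintegral_abs_deriv_mul measurableSet_Ioo
    (fun ψ _ => ((Real.hasDerivAt_sin ψ).const_mul 6).hasDerivWithinAt) hinj,
    ← lintegral_const_mul' _ _ (by norm_num)]
  refine lintegral_mono fun ψ => mul_le_mul_left ?_ _
  rw [ENNReal.ofReal_le_iff_le_toReal (by norm_num), abs_mul]
  have := Real.abs_cos_le_one ψ
  norm_num
  linarith

/-- The sum of the overlaps of the two pairs of opposite children has period `π / 2`, so its mean
over the angle at the root does not depend on the direction. -/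
theorem meanLength_sq_le (θ : ℝ) (n : ℕ) :
    meanLength θ n ^ 2 ≤ 20 * ∫⁻ u, (overlap θ n (6 * Real.cos (u + θ))
      + overlap θ n (6 * Real.sin (u + θ))) ∂angleLaw := by
  set H : ℝ → ℝ≥0∞ := fun ψ => overlap θ n (6 * Real.cos ψ) + overlap θ n (6 * Real.sin ψ) with hH
  have hper : Function.Periodic H (Real.pi / 2) := by
    intro ψ
    simp only [hH]
    rw [Real.cos_add_pi_div_two, Real.sin_add_pi_div_two, mul_neg, overlap_neg, add_comm]
  have hpi : 0 < Real.pi / 2 := by positivity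
  have hshift : ∫⁻ u in Set.Icc 0 (Real.pi / 2), H (u + θ)
      = ∫⁻ ψ in Set.Ioo 0 (Real.pi / 2), H ψ := by
    have h1 : ∫⁻ u in Set.Icc 0 (Real.pi / 2), H (u + θ)
        = ∫⁻ ψ in Set.Ioc θ (θ + Real.pi / 2), H ψ := by
      rw [setLIntegral_congr Ioc_ae_eq_Icc.symm, ← lintegral_indicator measurableSet_Ioc,
        ← lintegral_indicator measurableSet_Ioc,
        ← lintegral_add_right_eq_self ((Set.Ioc θ (θ + Real.pi / 2)).indicator H) θ]
      refine lintegral_congr fun u => ?_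
      simp only [Set.indicator, Set.mem_Ioc]
      refine if_congr ?_ rfl rfl
      constructor <;> rintro ⟨h, h'⟩ <;> constructor <;> linarith
    have h2 := (isAddFundamentalDomain_Ioc hpi θ).setLIntegral_eq
      (isAddFundamentalDomain_Ioc hpi 0) H (by
        rintro ⟨g, hg⟩ x
        obtain ⟨k, rfl⟩ := AddSubgroup.mem_zmultiples_iff.1 hg
        change H (k • (Real.pi / 2) + x) = H x
        rw [add_comm]
        exact hper.zsmul k x)
    rw [h1, h2, zero_add, setLIntegral_congr Ioo_ae_eq_Ioc.symm]
  have h20 : (12 : ℝ≥0∞) ≤ 20 * ENNReal.ofReal (2 / Real.pi) := by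
    have : (20 : ℝ≥0∞) = ENNReal.ofReal 20 := by norm_num
    rw [this, ← ENNReal.ofReal_mul (by norm_num)]
    rw [show (12 : ℝ≥0∞) = ENNReal.ofReal 12 by norm_num]
    refine ENNReal.ofReal_le_ofReal ?_
    rw [mul_div_assoc', le_div_iff₀ Real.pi_pos]
    nlinarith [Real.pi_lt_d2]
  calc meanLength θ n ^ 2 = 2 * ∫⁻ t in Set.Ioo 0 6, overlap θ n t := by
        rw [← lintegral_overlap, lintegral_overlap_eq_two_mul]
    _ ≤ 2 * (6 * ∫⁻ ψ in Set.Ioo 0 (Real.pi / 2), overlap θ n (6 * Real.sin ψ)) := by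
        gcongr
        exact lintegral_overlap_le_sin θ n
    _ = 12 * ∫⁻ ψ in Set.Ioo 0 (Real.pi / 2), overlap θ n (6 * Real.sin ψ) := by
        rw [← mul_assoc]
        norm_num
    _ ≤ 20 * ENNReal.ofReal (2 / Real.pi) * ∫⁻ ψ in Set.Ioo 0 (Real.pi / 2), H ψ :=
        mul_le_mul' h20 (lintegral_mono fun ψ => le_add_self)
    _ = 20 * ∫⁻ u, H (u + θ) ∂angleLaw := by
        rw [lintegral_angleLaw, hshift, mul_assoc]

/-! ### The recursive inequality for the mean length -/

/-- The union bound over four events, improved by the overlaps of two disjoint pairs of them. -/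
theorem one_sub_prod_add_le {p : Fin 4 → ℝ≥0∞} (hp : ∀ α, p α ≤ 1) :
    (1 - ∏ α, (1 - p α)) + (p 0 * p 2 + p 1 * p 3) ≤ ∑ α, p α := by
  have hlift (α : Fin 4) : ∃ x : ℝ, 0 ≤ x ∧ x ≤ 1 ∧ p α = ENNReal.ofReal x :=
    ⟨(p α).toReal, ENNReal.toReal_nonneg, ENNReal.toReal_le_of_le_ofReal zero_le_one
      (by simpa using hp α),
      (ENNReal.ofReal_toReal ((hp α).trans_lt ENNReal.one_lt_top).ne).symm⟩
  choose x hx0 hx1 hpx using hlift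
  have hsub (α : Fin 4) : 1 - ENNReal.ofReal (x α) = ENNReal.ofReal (1 - x α) := by
    rw [ENNReal.ofReal_sub _ (hx0 α), ENNReal.ofReal_one]
  have h0 (α : Fin 4) : 0 ≤ 1 - x α := sub_nonneg.2 (hx1 α)
  simp only [hpx, hsub]
  rw [← ENNReal.ofReal_prod_of_nonneg fun α _ => h0 α, ← ENNReal.ofReal_one,
    ← ENNReal.ofReal_sub _ (Finset.prod_nonneg fun α _ => h0 α), ← ENNReal.ofReal_mul (hx0 _),
    ← ENNReal.ofReal_mul (hx0 _), ← ENNReal.ofReal_add (mul_nonneg (hx0 _) (hx0 _))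
      (mul_nonneg (hx0 _) (hx0 _)), ← ENNReal.ofReal_sum_of_nonneg fun α _ => hx0 α,
    ← ENNReal.ofReal_add]
  · refine ENNReal.ofReal_le_ofReal ?_
    simp only [Fin.prod_univ_four, Fin.sum_univ_four]
    -- With `a` and `b` the probabilities of the two pairwise unions, this is `0 ≤ a * b`.
    have ha : 0 ≤ x 0 + x 2 - x 0 * x 2 := by nlinarith [hx0 0, hx0 2, hx1 0, hx1 2]
    have hb : 0 ≤ x 1 + x 3 - x 1 * x 3 := by nlinarith [hx0 1, hx0 3, hx1 1, hx1 3]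
    nlinarith [mul_nonneg ha hb]
  · rw [sub_nonneg]
    exact Finset.prod_le_one (fun α _ => h0 α) fun α _ => by linarith [hx0 α]
  · exact add_nonneg (mul_nonneg (hx0 _) (hx0 _)) (mul_nonneg (hx0 _) (hx0 _))

theorem lintegral_hitProb_mul_hitProb (θ : ℝ) (n : ℕ) (a b : ℝ) :
    ∫⁻ s, hitProb θ n (4 * (s - a)) * hitProb θ n (4 * (s - b))
      = 4⁻¹ * overlap θ n (4 * (a - b)) := by
  have hm := measurable_hitProb θ n
  rw [overlap, ← lintegral_comp_four_mul_sub
    (f := fun y => hitProb θ n y * hitProb θ n (y + 4 * (a - b))) (by fun_prop) a]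
  refine lintegral_congr fun s => ?_
  congr 2
  ring

theorem offset_zero_sub_two (θ u : ℝ) :
    4 * (offset θ u 0 - offset θ u 2) = 6 * Real.cos (u + θ) := by
  have h : ((2 : ℕ) : ℝ) * (Real.pi / 2) - u - θ = Real.pi - (u + θ) := by push_cast; ring
  have h' : ((0 : ℕ) : ℝ) * (Real.pi / 2) - u - θ = -(u + θ) := by push_cast; ring
  simp only [offset, Fin.val_zero, Fin.val_two]
  rw [h, h', Real.cos_pi_sub, Real.cos_neg]
  ring

theorem offset_one_sub_three (θ u : ℝ) :
    4 * (offset θ u 1 - offset θ u 3) = 6 * Real.sin (u + θ) := by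
  have h : ((1 : ℕ) : ℝ) * (Real.pi / 2) - u - θ = Real.pi / 2 - (u + θ) := by push_cast; ring
  have h' : ((3 : ℕ) : ℝ) * (Real.pi / 2) - u - θ = Real.pi / 2 - (u + θ) + Real.pi := by
    push_cast; ring
  have h3 : ((3 : Fin 4) : ℕ) = 3 := rfl
  simp only [offset, Fin.val_one, h3]
  rw [h, h', Real.cos_add_pi, Real.cos_pi_div_two_sub]
  ring

theorem meanLength_succ_add_le (θ : ℝ) (n : ℕ) :
    meanLength θ (n + 1) + 80⁻¹ * meanLength θ n ^ 2 ≤ meanLength θ n := by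
  have hm := measurable_hitProb θ n
  have ho (α : Fin 4) : Measurable fun u => offset θ u α :=
    measurable_offset measurable_const measurable_id α
  have hmean : meanLength θ (n + 1)
      = ∫⁻ u, ∫⁻ s, (1 - ∏ α, (1 - hitProb θ n (4 * (s - offset θ u α)))) ∂volume ∂angleLaw := by
    refine lintegral_lintegral_swap (Measurable.aemeasurable ?_)
    refine measurable_const.sub (Finset.measurable_prod _ fun α _ => measurable_const.sub
      (hm.comp ?_))
    exact (measurable_fst.sub ((ho α).comp measurable_snd)).const_mul 4
  have hpoint (u : ℝ) :
      (∫⁻ s, (1 - ∏ α, (1 - hitProb θ n (4 * (s - offset θ u α)))))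
        + 4⁻¹ * (overlap θ n (6 * Real.cos (u + θ)) + overlap θ n (6 * Real.sin (u + θ)))
        ≤ meanLength θ n := by
    rw [← offset_zero_sub_two, ← offset_one_sub_three, mul_add,
      ← lintegral_hitProb_mul_hitProb, ← lintegral_hitProb_mul_hitProb,
      ← lintegral_add_left (by fun_prop), ← lintegral_add_right _ (by fun_prop)]
    calc _ ≤ ∫⁻ s, ∑ α, hitProb θ n (4 * (s - offset θ u α)) :=
          lintegral_mono fun s => one_sub_prod_add_le fun α => hitProb_le_one θ n _
      _ = ∑ _α : Fin 4, 4⁻¹ * meanLength θ n := by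
          rw [lintegral_finsetSum _ fun α _ => by fun_prop]
          exact Finset.sum_congr rfl fun α _ => lintegral_comp_four_mul_sub hm _
      _ = meanLength θ n := by
          rw [Finset.sum_const, Finset.card_univ, Fintype.card_fin, nsmul_eq_mul, ← mul_assoc]
          norm_num [ENNReal.mul_inv_cancel]
  have hsq : 80⁻¹ * meanLength θ n ^ 2 ≤ ∫⁻ u, 4⁻¹ * (overlap θ n (6 * Real.cos (u + θ))
      + overlap θ n (6 * Real.sin (u + θ))) ∂angleLaw := by
    rw [lintegral_const_mul' _ _ (by norm_num)]
    refine (mul_le_mul_right (meanLength_sq_le θ n) _).trans_eq ?_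
    rw [← mul_assoc]
    congr 1
    rw [show (80 : ℝ≥0∞) = 4 * 20 by norm_num, ENNReal.mul_inv (by norm_num) (by norm_num),
      mul_assoc, ENNReal.inv_mul_cancel (by norm_num) (by norm_num), mul_one]
  have hov := measurable_overlap θ n
  calc meanLength θ (n + 1) + 80⁻¹ * meanLength θ n ^ 2
      ≤ (∫⁻ u, ∫⁻ s, (1 - ∏ α, (1 - hitProb θ n (4 * (s - offset θ u α)))) ∂volume ∂angleLaw)
        + ∫⁻ u, 4⁻¹ * (overlap θ n (6 * Real.cos (u + θ))
          + overlap θ n (6 * Real.sin (u + θ))) ∂angleLaw := by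
        rw [hmean]
        gcongr
    _ = ∫⁻ u, ((∫⁻ s, (1 - ∏ α, (1 - hitProb θ n (4 * (s - offset θ u α)))))
        + 4⁻¹ * (overlap θ n (6 * Real.cos (u + θ))
          + overlap θ n (6 * Real.sin (u + θ)))) ∂angleLaw := by
        rw [lintegral_add_right]
        fun_prop
    _ ≤ ∫⁻ _, meanLength θ n ∂angleLaw := lintegral_mono hpoint
    _ = meanLength θ n := by simp

theorem meanLength_le (θ : ℝ) {n : ℕ} (hn : 1 ≤ n) :
    meanLength θ n ≤ ENNReal.ofReal (80 / n) := by
  have hfin (k : ℕ) : meanLength θ k ≠ ∞ := ((meanLength_le_two θ k).trans_lt (by simp)).ne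
  have hrec (k : ℕ) :
      (meanLength θ (k + 1)).toReal + (meanLength θ k).toReal ^ 2 / 80
        ≤ (meanLength θ k).toReal := by
    have h := ENNReal.toReal_mono (hfin k) (meanLength_succ_add_le θ k)
    rw [ENNReal.toReal_add (hfin _) (ENNReal.mul_ne_top (by norm_num)
      (ENNReal.pow_ne_top (hfin k))), ENNReal.toReal_mul, ENNReal.toReal_pow] at h
    norm_num at h
    linarith
  have hmain (k : ℕ) : k * (meanLength θ k).toReal ≤ 80 := by
    induction k with
    | zero => simp
    | succ k ih =>
      have h0 : 0 ≤ (meanLength θ k).toReal := ENNReal.toReal_nonneg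
      have h2 : (meanLength θ k).toReal ≤ 2 :=
        ENNReal.toReal_le_of_le_ofReal (by norm_num) (by simpa using meanLength_le_two θ k)
      have h := hrec k
      set x := (meanLength θ k).toReal
      have hstep : ((k : ℝ) + 1) * (meanLength θ (k + 1)).toReal
          ≤ (k + 1) * (x - x ^ 2 / 80) :=
        mul_le_mul_of_nonneg_left (by linarith) (by positivity)
      push_cast
      -- From `k * x ≤ 80`: `(k + 1) * x * (1 - x / 80) ≤ (80 + x) * (1 - x / 80) ≤ 80`.
      have : ((k : ℝ) * x) * (1 - x / 80) ≤ 80 * (1 - x / 80) :=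
        mul_le_mul_of_nonneg_right ih (by linarith)
      nlinarith [sq_nonneg x]
  rw [← ENNReal.ofReal_toReal (hfin n)]
  refine ENNReal.ofReal_le_ofReal ?_
  rw [le_div_iff₀ (by exact_mod_cast hn), mul_comm]
  exact hmain n

/-! ### Independence of the subtrees -/

/-- An independent family indexed by a product is an independent family of families. -/
theorem iIndepFun_curry {Ω ι κ E : Type*} [MeasurableSpace Ω] {P : Measure Ω}
    [IsProbabilityMeasure P] [MeasurableSpace E] {X : ι × κ → Ω → E} (hX : ∀ p, Measurable (X p))
    (h : iIndepFun X P) : iIndepFun (fun i x (k : κ) => X (i, k) x) P := by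
  have hprob (p : ι × κ) : IsProbabilityMeasure (P.map (X p)) :=
    Measure.isProbabilityMeasure_map (hX p).aemeasurable
  rw [iIndepFun_iff_map_fun_eq_infinitePi_map fun i => measurable_pi_lambda _ fun k => hX (i, k)]
  have hi (i : ι) : P.map (fun x (k : κ) => X (i, k) x)
      = Measure.infinitePi fun k => P.map (X (i, k)) :=
    (h.precomp (Prod.mk_right_injective i)).map_fun_eq_infinitePi_map fun k => hX (i, k)
  simp_rw [hi]
  rw [← Measure.infinitePi_map_curry fun i k => P.map (X (i, k)),
    ← h.map_fun_eq_infinitePi_map hX, Measure.map_map (MeasurableEquiv.measurable _)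
      (measurable_pi_lambda _ hX)]
  rfl

/-- A member of an independent family is independent of the family of the others. -/
theorem indepFun_of_iIndepFun_of_notMem_range {Ω ι κ E : Type*} [MeasurableSpace Ω]
    {P : Measure Ω} [MeasurableSpace E] {X : ι → Ω → E} (hX : ∀ i, Measurable (X i))
    (h : iIndepFun X P) (i : ι) {g : κ → ι} (hg : i ∉ Set.range g) :
    IndepFun (X i) (fun x k => X (g k) x) P := by
  have hdis : Disjoint {i} (Set.range g) := Set.disjoint_singleton_left.2 hg
  have hind := indep_iSup_of_disjoint (fun j => (hX j).comap_le) h.iIndep hdis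
  rw [IndepFun_iff_Indep]
  refine indep_of_indep_of_le_left (indep_of_indep_of_le_right hind ?_) ?_
  · rw [MeasurableSpace.pi, MeasurableSpace.comap_iSup]
    refine iSup_le fun k => ?_
    rw [MeasurableSpace.comap_comp]
    exact le_iSup₂_of_le (f := fun j (_ : j ∈ Set.range g) => MeasurableSpace.comap (X j) _)
      (g k) ⟨k, rfl⟩ le_rfl
  · simp

section Tree

variable {Ω : Type*} [MeasurableSpace Ω] {P : Measure Ω} {ω : Node → Ω → ℝ}

theorem IsUniformTree.mono {S T : Set Node} (h : IsUniformTree P T ω) (hST : S ⊆ T) :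
    IsUniformTree P S ω where
  measurable w hw := h.measurable w (hST hw)
  uniform w hw := h.uniform w (hST hw)
  indep := h.indep.precomp (Set.inclusion_injective hST)

theorem append_singleton_mem_nodesOfHeight {n : ℕ} {w : Node} (hw : w ∈ nodesOfHeight n)
    (α : Fin 4) : w ++ [α] ∈ nodesOfHeight (n + 1) := by
  simpa [nodesOfHeight] using hw

theorem nil_mem_nodesOfHeight (n : ℕ) : [] ∈ nodesOfHeight (n + 1) := by
  simp [nodesOfHeight]

theorem IsUniformTree.subtree {n : ℕ} (h : IsUniformTree P (nodesOfHeight (n + 1)) ω)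
    (α : Fin 4) : IsUniformTree P (nodesOfHeight n) (subtree α ω) where
  measurable w hw := h.measurable _ (append_singleton_mem_nodesOfHeight hw α)
  uniform w hw := h.uniform _ (append_singleton_mem_nodesOfHeight hw α)
  indep := by
    refine h.indep.precomp (g := fun w : nodesOfHeight n =>
      ⟨w ++ [α], append_singleton_mem_nodesOfHeight w.2 α⟩) fun v w hvw => ?_
    simpa [Subtype.ext_iff] using hvw

/-- The extension by zero of angles on the tree of height `n` to the infinite tree. -/
noncomputable def extend (n : ℕ) (z : nodesOfHeight n → ℝ) (w : Node) : ℝ :=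
  open Classical in if h : w ∈ nodesOfHeight n then z ⟨w, h⟩ else 0

theorem shadow_extend (θ : ℝ) (n : ℕ) (ω : Node → ℝ) :
    shadow θ n (extend n fun w => ω w) = shadow θ n ω :=
  shadow_congr θ n fun w hw => by simp [extend, hw]

theorem measurableSet_mem_shadow_extend {X : Type*} [MeasurableSpace X] (θ : ℝ) (n : ℕ)
    {s : X → ℝ} {z : X → nodesOfHeight n → ℝ} (hs : Measurable s) (hz : Measurable z) :
    MeasurableSet {x | s x ∈ shadow θ n (extend n (z x))} := by
  refine measurableSet_mem_shadow (θ := fun _ => θ) measurable_const n hs fun w hw => ?_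
  simp only [extend, hw, dite_true]
  exact (measurable_pi_apply _).comp hz

/-! ### Measurability of the Favard length -/

/-- The mean length of the shadows over all directions, an upper bound for the Favard length. -/
noncomputable def favardShadow (n : ℕ) (ω : Node → ℝ) : ℝ≥0∞ :=
  ENNReal.ofReal (1 / Real.pi) * ∫⁻ θ in Set.Icc (0 : ℝ) Real.pi, volume (shadow θ n ω)

theorem favardLength_generation_le (n : ℕ) (ω : Node → ℝ) :
    favardLength (generation n ω) ≤ favardShadow n ω :=
  mul_le_mul_right (lintegral_mono fun θ => projLength_generation_le θ n ω) _

theorem measurable_volume_shadow {n : ℕ} (h : IsUniformTree P (nodesOfHeight n) ω) :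
    Measurable fun p : Ω × ℝ => volume (shadow p.2 n fun w => ω w p.1) := by
  have hm : MeasurableSet {q : (Ω × ℝ) × ℝ | q.2 ∈ shadow q.1.2 n fun w => ω w q.1.1} :=
    measurableSet_mem_shadow (measurable_snd.comp measurable_fst) n measurable_snd
      fun w hw => (h.measurable w hw).comp (measurable_fst.comp measurable_fst)
  exact measurable_measure_prodMk_left hm

theorem measurable_favardShadow {n : ℕ} (h : IsUniformTree P (nodesOfHeight n) ω) :
    Measurable fun x => favardShadow n fun w => ω w x :=
  (measurable_volume_shadow h).lintegral_prod_right'.const_mul _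

/-! ### The expected length of the random shadow -/

variable [IsProbabilityMeasure P]

/-- Given the angle `u` at the root, the events that the four children miss `s` are independent,
and their probabilities are those of the four subtrees. -/
theorem measure_mem_shadow (θ : ℝ) (n : ℕ) :
    ∀ {ω : Node → Ω → ℝ}, IsUniformTree P (nodesOfHeight n) ω → ∀ s : ℝ,
      P {x | s ∈ shadow θ n fun w => ω w x} = hitProb θ n s := by
  induction n with
  | zero =>
    intro ω _ s
    by_cases hs : s ∈ Set.Icc (-1 : ℝ) 1 <;> simp only [shadow, hitProb, hs] <;> simp [hs]
  | succ n ih =>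
    intro ω h s
    set X : nodesOfHeight (n + 1) → Ω → ℝ := fun w => ω w with hXdef
    have hX (w : nodesOfHeight (n + 1)) : Measurable (X w) := h.measurable w w.2
    set g : Fin 4 × nodesOfHeight n → nodesOfHeight (n + 1) := fun p =>
      ⟨p.2 ++ [p.1], append_singleton_mem_nodesOfHeight p.2.2 p.1⟩ with hg
    have hginj : Function.Injective g := by
      rintro ⟨α, v⟩ ⟨β, w⟩ hvw
      simp only [hg, Subtype.mk.injEq] at hvw
      obtain ⟨h1, h2⟩ := List.append_inj' hvw rfl
      simp only [List.cons.injEq, and_true] at h2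
      exact Prod.ext h2 (Subtype.ext h1)
    set Z : Fin 4 → Ω → nodesOfHeight n → ℝ := fun α x w => X (g (α, w)) x with hZdef
    have hZα (α : Fin 4) : Measurable (Z α) := measurable_pi_lambda _ fun w => hX _
    have hZ : Measurable fun x α => Z α x := measurable_pi_lambda _ hZα
    have hroot : Measurable (ω []) := h.measurable _ (nil_mem_nodesOfHeight n)
    have hlaw : P.map (ω []) = angleLaw := h.uniform _ (nil_mem_nodesOfHeight n)
    have hind : iIndepFun Z P := iIndepFun_curry (fun p => hX (g p)) (h.indep.precomp hginj)
    have hindroot : IndepFun (ω []) (fun x α => Z α x) P := by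
      have := indepFun_of_iIndepFun_of_notMem_range hX h.indep ⟨[], nil_mem_nodesOfHeight n⟩
        (g := g) (by rintro ⟨p, hp⟩; simp [hg] at hp)
      exact this.comp (φ := id) (ψ := fun z α w => z (α, w)) measurable_id (by fun_prop)
    set E : ℝ → Fin 4 → Set (nodesOfHeight n → ℝ) := fun u α =>
      {z | 4 * (s - offset θ u α) ∈ shadow θ n (extend n z)} with hE
    have hEm (u : ℝ) (α : Fin 4) : MeasurableSet (E u α) :=
      measurableSet_mem_shadow_extend θ n measurable_const measurable_id
    have hEP (u : ℝ) (α : Fin 4) :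
        P.map (Z α) (E u α) = hitProb θ n (4 * (s - offset θ u α)) := by
      rw [Measure.map_apply (hZα α) (hEm u α), ← ih (h.subtree α)]
      congr 1
      ext x
      exact Set.ext_iff.1 (shadow_extend θ n fun w => subtree α ω w x) _
    have hprob (α : Fin 4) : IsProbabilityMeasure (P.map (Z α)) :=
      Measure.isProbabilityMeasure_map (hZα α).aemeasurable
    set T : Set (ℝ × (Fin 4 → nodesOfHeight n → ℝ)) := {p | ∃ α, p.2 α ∈ E p.1 α} with hT
    have hTm : MeasurableSet T := by
      rw [hT, Set.ofPred_exists]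
      refine MeasurableSet.iUnion fun α => measurableSet_mem_shadow_extend θ n
        (s := fun p : ℝ × (Fin 4 → nodesOfHeight n → ℝ) => 4 * (s - offset θ p.1 α))
        (z := fun p => p.2 α) ?_ (by fun_prop)
      exact (measurable_const.sub (measurable_offset measurable_const measurable_fst α)).const_mul 4
    have hset : {x | s ∈ shadow θ (n + 1) fun w => ω w x}
        = (fun x => (ω [] x, fun α => Z α x)) ⁻¹' T := by
      ext x
      refine exists_congr fun α => ?_
      exact Set.ext_iff.1 (shadow_extend θ n fun w => subtree α ω w x).symm _
    rw [hset, ← Measure.map_apply (hroot.prodMk hZ) hTm,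
      (indepFun_iff_map_prod_eq_prod_map_map hroot.aemeasurable hZ.aemeasurable).1 hindroot,
      Measure.prod_apply hTm, hlaw, hitProb, hind.map_fun_eq_pi_map fun α => (hZα α).aemeasurable]
    refine lintegral_congr fun u => ?_
    have hcompl : Prod.mk u ⁻¹' T = (Set.univ.pi fun α => (E u α)ᶜ)ᶜ := by
      ext z
      simp [hT]
    rw [hcompl, prob_compl_eq_one_sub (.univ_pi fun α => (hEm u α).compl), Measure.pi_pi]
    simp_rw [prob_compl_eq_one_sub (hEm u _), hEP]

theorem lintegral_volume_shadow {n : ℕ} (h : IsUniformTree P (nodesOfHeight n) ω) (θ : ℝ) :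
    ∫⁻ x, volume (shadow θ n fun w => ω w x) ∂P = meanLength θ n := by
  have hm : MeasurableSet {p : Ω × ℝ | p.2 ∈ shadow θ n fun w => ω w p.1} :=
    measurableSet_mem_shadow (θ := fun _ => θ) measurable_const n measurable_snd
      fun w hw => (h.measurable w hw).comp measurable_fst
  calc ∫⁻ x, volume (shadow θ n fun w => ω w x) ∂P
      = (P.prod volume) {p : Ω × ℝ | p.2 ∈ shadow θ n fun w => ω w p.1} :=
        (Measure.prod_apply hm).symm
    _ = ∫⁻ s, P {x | s ∈ shadow θ n fun w => ω w x} := Measure.prod_apply_symm hm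
    _ = meanLength θ n := lintegral_congr fun s => measure_mem_shadow θ n h s

/-! ### The expected Favard length -/

theorem lintegral_favardShadow_le {n : ℕ} (hn : 1 ≤ n)
    (h : IsUniformTree P (nodesOfHeight n) ω) :
    ∫⁻ x, favardShadow n (fun w => ω w x) ∂P ≤ ENNReal.ofReal (80 / n) := by
  have hm := measurable_volume_shadow h
  unfold favardShadow
  rw [lintegral_const_mul _ hm.lintegral_prod_right', lintegral_lintegral_swap hm.aemeasurable]
  calc _ ≤ ENNReal.ofReal (1 / Real.pi)
        * ∫⁻ _ in Set.Icc (0 : ℝ) Real.pi, ENNReal.ofReal (80 / n) := by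
        gcongr with θ
        rw [lintegral_volume_shadow h]
        exact meanLength_le θ hn
    _ = ENNReal.ofReal (80 / n) := by
        rw [setLIntegral_const, Real.volume_Icc, sub_zero, mul_left_comm,
          ← ENNReal.ofReal_mul (by positivity), one_div_mul_cancel Real.pi_ne_zero,
          ENNReal.ofReal_one, mul_one]

/-- By Fatou's lemma, `liminf n * Fav` has a finite expectation. -/
theorem ae_liminf_favardLength_lt_top (h : IsUniformTree P Set.univ ω) :
    ∀ᵐ x ∂P, liminf (fun n : ℕ => (n : ℝ≥0∞) * favardLength (generation n fun w => ω w x)) atTop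
      < ∞ := by
  have hn (n : ℕ) : IsUniformTree P (nodesOfHeight n) ω := h.mono (Set.subset_univ _)
  have hm (n : ℕ) : Measurable fun x => (n : ℝ≥0∞) * favardShadow n fun w => ω w x :=
    (measurable_favardShadow (hn n)).const_mul _
  have hle (n : ℕ) : ∫⁻ x, (n : ℝ≥0∞) * favardShadow n (fun w => ω w x) ∂P ≤ 80 := by
    rcases Nat.eq_zero_or_pos n with rfl | hpos
    · simp
    rw [lintegral_const_mul _ (measurable_favardShadow (hn n))]
    have hpos' : (0 : ℝ) < n := by exact_mod_cast hpos
    calc (n : ℝ≥0∞) * _ ≤ ENNReal.ofReal n * ENNReal.ofReal (80 / n) := by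
          rw [ENNReal.ofReal_natCast]
          exact mul_le_mul_right (lintegral_favardShadow_le hpos (hn n)) _
      _ = 80 := by
          rw [← ENNReal.ofReal_mul hpos'.le, mul_div_cancel₀ _ hpos'.ne']
          norm_num
  have hint : ∫⁻ x, liminf (fun n : ℕ => (n : ℝ≥0∞) * favardShadow n fun w => ω w x) atTop ∂P
      ≠ ∞ := by
    refine ((lintegral_liminf_le hm).trans ?_).trans_lt (by norm_num : (80 : ℝ≥0∞) < ∞) |>.ne
    exact (liminf_le_liminf (Eventually.of_forall hle)).trans_eq (liminf_const 80)
  filter_upwards [ae_lt_top (Measurable.liminf hm) hint] with x hx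
  refine lt_of_le_of_lt (liminf_le_liminf (Eventually.of_forall fun n => ?_)) hx
  exact mul_le_mul_right (favardLength_generation_le n _) _

end Tree

end DiskCantor

theorem mainTheorem1 :
    ∃ c : ℝ, 0 < c ∧
      ∀ (Ω : Type*) [MeasurableSpace Ω] (P : Measure Ω) [IsProbabilityMeasure P]
        (ω : DiskCantor.Node → Ω → ℝ),
        (∀ n : ℕ, 1 ≤ n → DiskCantor.IsUniformTree P (DiskCantor.nodesOfHeight n) ω →
          (∀ θ : ℝ,
            ∫⁻ x, DiskCantor.projLength θ (DiskCantor.generation n (fun w => ω w x)) ∂P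
              ≤ ENNReal.ofReal (c / n)) ∧
          ∫⁻ x, DiskCantor.favardLength (DiskCantor.generation n (fun w => ω w x)) ∂P
            ≤ ENNReal.ofReal (c / n)) ∧
        (DiskCantor.IsUniformTree P Set.univ ω →
          ∀ᵐ x ∂P,
            liminf (fun n : ℕ =>
              (n : ℝ≥0∞) * DiskCantor.favardLength (DiskCantor.generation n (fun w => ω w x)))
              atTop < ∞) := by
  refine ⟨80, by norm_num, fun Ω _ P _ ω => ⟨fun n hn h => ⟨fun θ => ?_, ?_⟩, fun h => ?_⟩⟩
  · refine (lintegral_mono fun x => DiskCantor.projLength_generation_le θ n _).trans ?_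
    rw [DiskCantor.lintegral_volume_shadow h]
    exact DiskCantor.meanLength_le θ hn
  · exact (lintegral_mono fun x => DiskCantor.favardLength_generation_le n _).trans
      (DiskCantor.lintegral_favardShadow_le hn h)
  · exact DiskCantor.ae_liminf_favardLength_lt_top h
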